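/- **Theorem (Renormalized Lerch zeta functions).** For real $0<a,c<1$ let $\zeta(s,a,c)$ denote the Lerch zeta function, i.e. the analytic continuation, as an entire function of $s\in\mathbb C$, of the series $\sum_{n\ge 0} e^{2\pi i n a}(n+c)^{-s}$, which converges absolutely for $\Re(s)>1$. Let $k\in\{0,1\}$ and write $\pm=(-1)^k$. Put $$L^{\pm}(s,a,c)=\zeta(s,a,c)\pm e^{-2\pi i a}\zeta(s,1-a,1-c),$$ and let $$\gamma^{+}(s)=\frac{\pi^{-s/2}\Gamma(\frac s2)}{\pi^{-(1-s)/2}\Gamma(\frac{1-s}2)},\qquad \gamma^{-}(s)=\frac{\pi^{-(s+1)/2}\Gamma(\frac{s+1}2)}{\pi^{-(2-s)/2}\Gamma(\frac{2-s}2)}$$ be the Tate gamma functions. For $s\in\mathbb C\smallsetminus\mathbb Z$ and $(a,c)\in(0,1)^2$ define $L^{R,\pm}(s,a,c)=L^{\pm}(s,a,c)-S^{\pm}(s,a,c)$, where $$S^{\pm}(s,a,c)=c^{-s}+(-1)^k e^{-2\pi i a}(1-c)^{-s}+i^k\gamma^{\pm}(1-s)\left\{e^{-2\pi i ac}a^{s-1}+(-1)^k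 e^{2\pi i(1-a)c}(1-a)^{s-1}\right\}.$$ (1) For each fixed $s\in\mathbb C\smallsetminus\mathbb Z$ the function $L^{R,\pm}(s,a,c)$ extends continuously from $(0,1)^2$ to the closed unit square $[0,1]^2$ in the variables $(a,c)$. The (unique) extension is again denoted by $L^{R,\pm}(s,a,c)$. (2) For each fixed $(a,c)\in[0,1]^2$ the function $s\mapsto L^{R,\pm}(s,a,c)$ is meromorphic on $\mathbb C$, with at most simple poles, all of them in $\mathbb Z$. (3) For all $s\in\mathbb C\smallsetminus\mathbb Z$ and $(a,c)\in[0,1]^2$ the completed functions $$\hat L^{R,\pm}(s,a,c)=\pi^{-\frac{s+k}2}\,\Gamma\!\left(\tfrac{s+k}2\right)L^{R,\pm}(s,a,c)$$ satisfy $$\hat L^{R,\pm}(s,a,c)=w_\pm\, e^{-2\pi i ac}\,\hat L^{R,\pm}(1-s,1-c,a),\qquad w_+=1,\quad w_-=i.$$ -/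

import Mathlib

open Complex Set Filter Topology

/-- `f` is the analytic continuation to all `s ∈ ℂ` of the Lerch series
`∑_{n ≥ 0} e^{2 π i n a} (n + c)^{-s}`, which converges absolutely for `Re s > 1`. -/
def IsLerchContinuation (a c : ℝ) (f : ℂ → ℂ) : Prop :=
  Differentiable ℂ f ∧
    ∀ s : ℂ, 1 < s.re →
      HasSum (fun n : ℕ => exp (2 * Real.pi * I * n * a) * ((n : ℂ) + c) ^ (-s)) (f s)

/-- The continuation is unique, so the choice made in `lerchZeta` is immaterial. -/
theorem IsLerchContinuation.unique {a c : ℝ} {f g : ℂ → ℂ}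
    (hf : IsLerchContinuation a c f) (hg : IsLerchContinuation a c g) : f = g := by
  have hf' : AnalyticOnNhd ℂ f univ := hf.1.differentiableOn.analyticOnNhd isOpen_univ
  have hg' : AnalyticOnNhd ℂ g univ := hg.1.differentiableOn.analyticOnNhd isOpen_univ
  refine hf'.eq_of_eventuallyEq (z₀ := 2) hg' ?_
  have ho : IsOpen {s : ℂ | 1 < s.re} := isOpen_lt continuous_const continuous_re
  filter_upwards [ho.mem_nhds (show (2 : ℂ) ∈ {s : ℂ | 1 < s.re} by simp)] with s hs
  exact (hf.2 s hs).unique (hg.2 s hs)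

open Classical in
/-- The Lerch zeta function `ζ(s, a, c)`: the value at `s` of the entire continuation of the
Lerch series (used for `0 < a < 1`, `0 < c < 1`, where this continuation exists). -/
noncomputable def lerchZeta (s : ℂ) (a c : ℝ) : ℂ :=
  if h : ∃ f : ℂ → ℂ, IsLerchContinuation a c f then h.choose s else 0

/-- `L^±(s, a, c) = ζ(s, a, c) ± e^{-2 π i a} ζ(s, 1 - a, 1 - c)` with `± = (-1)^k`:
here and below `k = 0` is the sign `+` and `k = 1` is the sign `-`. -/
noncomputable def lerchL (k : Fin 2) (s : ℂ) (a c : ℝ) : ℂ :=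
  lerchZeta s a c +
    (-1) ^ (k : ℕ) * exp (-2 * Real.pi * I * a) * lerchZeta s (1 - a) (1 - c)

/-- The Tate gamma functions
`γ^+(s) = π^{-s/2} Γ(s/2) / (π^{-(1-s)/2} Γ((1-s)/2))` and
`γ^-(s) = π^{-(s+1)/2} Γ((s+1)/2) / (π^{-(2-s)/2} Γ((2-s)/2))`.
Recall `Gammaℝ s = π^{-s/2} Γ(s/2)`. -/
noncomputable def tateGamma (k : Fin 2) (s : ℂ) : ℂ :=
  Gammaℝ (s + (k : ℕ)) / Gammaℝ (1 - s + (k : ℕ))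

/-- The correction term `S^±(s, a, c)`. -/
noncomputable def lerchCorrection (k : Fin 2) (s : ℂ) (a c : ℝ) : ℂ :=
  ((c : ℂ) ^ (-s) +
      (-1) ^ (k : ℕ) * exp (-2 * Real.pi * I * a) * ((1 - c : ℝ) : ℂ) ^ (-s)) +
    I ^ (k : ℕ) * tateGamma k (1 - s) *
      (exp (-2 * Real.pi * I * a * c) * (a : ℂ) ^ (s - 1) +
        (-1) ^ (k : ℕ) * exp (2 * Real.pi * I * (1 - a) * c) *
          ((1 - a : ℝ) : ℂ) ^ (s - 1))

/-- The closed unit square. -/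
def closedSquare : Set (ℝ × ℝ) := Icc 0 1 ×ˢ Icc 0 1

/-- The open unit square. -/
def openSquare : Set (ℝ × ℝ) := Ioo 0 1 ×ˢ Ioo 0 1

/-- The renormalized Lerch function `L^{R,±}(s, a, c) = L^±(s, a, c) - S^±(s, a, c)`
on the open unit square (for `s ∉ ℤ`). -/
noncomputable def renormLerchInterior (k : Fin 2) (s : ℂ) (p : ℝ × ℝ) : ℂ :=
  lerchL k s p.1 p.2 - lerchCorrection k s p.1 p.2

/-- The renormalized Lerch function on the closed unit square (for `s ∉ ℤ`): the value at
`(a, c)` is the limit of `L^{R,±}(s, ·, ·)` along points of the open square tending to `(a, c)`. -/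
noncomputable def renormLerch (k : Fin 2) (s : ℂ) (a c : ℝ) : ℂ :=
  extendFrom openSquare (renormLerchInterior k s) (a, c)

/-- The completed renormalized Lerch function
`π^{-(s+k)/2} Γ((s+k)/2) L^{R,±}(s, a, c)`. -/
noncomputable def completedRenormLerch (k : Fin 2) (s : ℂ) (a c : ℝ) : ℂ :=
  Gammaℝ (s + (k : ℕ)) * renormLerch k s a c

/-! For `0 < a, c < 1`, `L^±(s, a, c)` is the bilateral series `∑ sgn(n + c)^k e^{2πina} |n +
c|^{-s}`, that is, the Mellin transform at `(s + k)/2` of a theta series of weight `k`, divided by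
`Gammaℝ (s + k)`. Jacobi's transformation exchanges `(a, c)` with `(1 - c, a)`. Cutting the Mellin
integral at `t = 1` therefore leaves two integrals over `(1, ∞)`, one at `s` with `(a, c)` and one
at `1 - s` with `(1 - c, a)` (`mellin_eq_upperMellin_add`, `theta_functional_equation`).

On `t ≥ 1` all theta terms decay uniformly on the closed square, except `n = 0` (as `c → 0`) and `n
= -1` (as `c → 1`). Each exceptional term integrates to an upper incomplete gamma function, which is
a full gamma factor minus a lower incomplete one (`upperMellin_exp`). The full gamma factors from
the two integrals add up to exactly `S^±` (`renormLerchInterior_eq`). What remains is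
`renormExplicit`, made of tails that are entire in `s` and continuous on the closed square, and of
the series `∑ (-x)^j / (j! (z + j))`, which is continuous in `x` down to `0` and has at most simple
poles in `z`.

This formula gives continuity and meromorphy. It also gives the functional equation, since its two
summands are exchanged by the duality up to the explicit factor (`renormUpper_reflection`). -/

namespace Lerch

open MeasureTheory Asymptotics
open scoped Real

/-! ### Truncated Mellin transforms. -/

/-- The Mellin transform truncated to `(1, ∞)`. -/
noncomputable def upperMellin (F : ℝ → ℂ) (z : ℂ) : ℂ :=
  mellin (indicator (Ioi 1) F) z

theorem upperMellin_eq_integral (F : ℝ → ℂ) (z : ℂ) :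
    upperMellin F z = ∫ t in Ioi (1 : ℝ), (t : ℂ) ^ (z - 1) * F t := by
  have h : ∀ t : ℝ, (t : ℂ) ^ (z - 1) • indicator (Ioi 1) F t =
      indicator (Ioi 1) (fun t : ℝ => (t : ℂ) ^ (z - 1) * F t) t := by
    intro t
    by_cases ht : t ∈ Ioi (1 : ℝ) <;> simp [ht]
  simp_rw [upperMellin, mellin, h]
  rw [setIntegral_indicator measurableSet_Ioi,
    inter_eq_right.mpr (Ioi_subset_Ioi zero_le_one)]

theorem upperMellin_congr {F G : ℝ → ℂ} (h : EqOn F G (Ioi 1)) : upperMellin F = upperMellin G := by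
  ext z
  rw [upperMellin, upperMellin, indicator_congr h]

/-- The truncation vanishes near `0`, so every exponent is allowed there. This is why the truncated
transform of an exponentially decaying function is entire. -/
theorem isBigO_indicator_nhdsGT_zero (F : ℝ → ℂ) (b : ℝ) :
    indicator (Ioi 1) F =O[𝓝[>] 0] fun t : ℝ => t ^ b := by
  refine (isBigO_zero (fun t : ℝ => t ^ b) _).congr' ?_ EventuallyEq.rfl
  filter_upwards [nhdsWithin_le_nhds (Iio_mem_nhds zero_lt_one)] with t ht
  rw [indicator_of_notMem (by simpa using (mem_Iio.mp ht).le)]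

theorem locallyIntegrableOn_indicator {F : ℝ → ℂ} (hF : ContinuousOn F (Ici 1)) :
    LocallyIntegrableOn (indicator (Ioi 1) F) (Ioi 0) := by
  have h : LocallyIntegrableOn F (Ici 1) := hF.locallyIntegrableOn measurableSet_Ici
  rw [locallyIntegrableOn_iff isOpen_Ioi.isLocallyClosed]
  intro K _ hK
  rw [integrableOn_indicator_iff measurableSet_Ioi]
  refine ((h.integrableOn_compact_subset (t := K ∩ Ici 1) inter_subset_right
    (hK.inter_right isClosed_Ici))).mono_set ?_
  exact fun x hx => ⟨hx.2, mem_Ici.mpr (mem_Ioi.mp hx.1).le⟩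

theorem isBigO_indicator_atTop {F : ℝ → ℂ} {g : ℝ → ℝ} (h : F =O[atTop] g) :
    indicator (Ioi 1) F =O[atTop] g := by
  refine h.congr' ?_ EventuallyEq.rfl
  filter_upwards [Ioi_mem_atTop 1] with t ht
  rw [indicator_of_mem ht]

theorem mellinConvergent_indicator {F : ℝ → ℂ} (hF : ContinuousOn F (Ici 1)) {b : ℝ} (hb : 0 < b)
    (hO : F =O[atTop] fun t => Real.exp (-b * t)) (z : ℂ) :
    MellinConvergent (indicator (Ioi 1) F) z :=
  mellinConvergent_of_isBigO_rpow_exp hb (locallyIntegrableOn_indicator hF)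
    (isBigO_indicator_atTop hO) (isBigO_indicator_nhdsGT_zero F (-(z.re - 1))) (sub_one_lt _)

theorem differentiable_upperMellin {F : ℝ → ℂ} (hF : ContinuousOn F (Ici 1)) {b : ℝ} (hb : 0 < b)
    (hO : F =O[atTop] fun t => Real.exp (-b * t)) : Differentiable ℂ (upperMellin F) := fun z =>
  mellin_differentiableAt_of_isBigO_rpow_exp hb (locallyIntegrableOn_indicator hF)
    (isBigO_indicator_atTop hO) (isBigO_indicator_nhdsGT_zero F (-(z.re - 1))) (sub_one_lt _)

theorem upperMellin_add {F G : ℝ → ℂ} {z : ℂ} (hF : MellinConvergent (indicator (Ioi 1) F) z)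
    (hG : MellinConvergent (indicator (Ioi 1) G) z) :
    upperMellin (fun t => F t + G t) z = upperMellin F z + upperMellin G z := by
  rw [upperMellin, upperMellin, upperMellin, ← (hasMellin_add hF hG).2]
  congr 1
  ext t
  exact congrFun (indicator_add (Ioi 1) F G) t

theorem upperMellin_const_mul (F : ℝ → ℂ) (w z : ℂ) :
    upperMellin (fun t => w * F t) z = w * upperMellin F z := by
  rw [upperMellin, upperMellin, ← smul_eq_mul, ← mellin_const_smul]
  congr 1
  ext t
  exact congrFun (indicator_const_smul (Ioi 1) w F) t

theorem mellinConvergent_indicator_const_mul {F : ℝ → ℂ} {z : ℂ} (w : ℂ)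
    (hF : MellinConvergent (indicator (Ioi 1) F) z) :
    MellinConvergent (indicator (Ioi 1) fun t => w * F t) z := by
  have := hF.const_smul w
  convert! this using 1
  ext t
  exact congrFun (indicator_const_smul (Ioi 1) w F) t

/-- A Mellin transform with a functional equation, written through truncated transforms. -/
theorem mellin_eq_upperMellin_add {f g : ℝ → ℂ} {κ : ℝ} {ε : ℂ}
    (hfg : ∀ t ∈ Ioi (0 : ℝ), f (1 / t) = ε * ((t ^ κ : ℝ) : ℂ) * g t) {z : ℂ}
    (hf : MellinConvergent f z) :
    mellin f z = upperMellin f z + ε * upperMellin g (κ - z) := by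
  have h1 : mellin f z = (∫ t in Ioo (0 : ℝ) 1, (t : ℂ) ^ (z - 1) • f t) +
      ∫ t in Ioi (1 : ℝ), (t : ℂ) ^ (z - 1) • f t := by
    rw [← integral_Ioc_eq_integral_Ioo, mellin, ← Ioc_union_Ioi_eq_Ioi zero_le_one]
    rw [MellinConvergent, ← Ioc_union_Ioi_eq_Ioi zero_le_one] at hf
    exact setIntegral_union (Ioc_disjoint_Ioi le_rfl) measurableSet_Ioi hf.left_of_union
      hf.right_of_union
  have h2 : (∫ t in Ioo (0 : ℝ) 1, (t : ℂ) ^ (z - 1) • f t) = ε * upperMellin g (κ - z) := by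
    -- The substitution `t ↦ 1/t` is carried out by the Mellin rules for inversion and for
    -- multiplication by a power.
    have h3 : upperMellin g (κ - z) =
        mellin (fun t : ℝ => (t : ℂ) ^ (-κ : ℂ) • indicator (Ioi 1) g t⁻¹) z := by
      rw [mellin_cpow_smul _ z (-κ), mellin_comp_inv (indicator (Ioi 1) g), upperMellin]
      congr 1
      ring
    rw [h3, ← smul_eq_mul, ← mellin_const_smul, mellin,
      ← inter_eq_right.mpr (Ioo_subset_Ioi_self : Ioo (0 : ℝ) 1 ⊆ Ioi 0),
      ← setIntegral_indicator measurableSet_Ioo]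
    refine setIntegral_congr_fun measurableSet_Ioi fun t (ht : 0 < t) => ?_
    by_cases h : t < 1
    · have h4 : t⁻¹ ∈ Ioi (1 : ℝ) := (one_lt_inv₀ ht).mpr h
      have h5 := hfg t⁻¹ (inv_pos.mpr ht)
      rw [one_div, inv_inv] at h5
      simp only [indicator_of_mem (show t ∈ Ioo (0 : ℝ) 1 from ⟨ht, h⟩), indicator_of_mem h4,
        smul_eq_mul, h5]
      rw [Real.inv_rpow ht.le, ← Real.rpow_neg ht.le, ofReal_cpow ht.le]
      push_cast
      ring
    · have h4 : t⁻¹ ∉ Ioi (1 : ℝ) := by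
        rw [mem_Ioi, not_lt]
        exact inv_le_one_of_one_le₀ (not_lt.mp h)
      simp [indicator_of_notMem h4, h]
  rw [h1, h2, upperMellin_eq_integral f z, add_comm]
  rfl

/-! ### Theta series with characteristics and Jacobi's transformation. -/

/-- The terms of the theta series with characteristics `a`, `c` and weight `k`. -/
noncomputable def thetaTerm (k : ℕ) (a c t : ℝ) (n : ℤ) : ℂ :=
  ((n : ℂ) + c) ^ k * exp (2 * π * I * n * a) * (Real.exp (-π * (n + c) ^ 2 * t) : ℝ)

/-- The theta series with characteristics `a`, `c` and weight `k`. -/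
noncomputable def theta (k : ℕ) (a c t : ℝ) : ℂ := ∑' n : ℤ, thetaTerm k a c t n

/-- Expanding `(n + c)^2` absorbs the cross term `2nc` into the elliptic variable, which becomes `a
+ ict`. -/
theorem thetaTerm_zero (a c t : ℝ) (n : ℤ) :
    thetaTerm 0 a c t n =
      exp (-π * c ^ 2 * t) * jacobiTheta₂_term n (a + I * c * t) (I * t) := by
  rw [thetaTerm, jacobiTheta₂_term, pow_zero, one_mul, ofReal_exp, ← exp_add, ← exp_add]
  congr 1
  push_cast
  linear_combination (2 * π * n * c * t + π * n ^ 2 * t : ℂ) * (-I_sq)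

theorem thetaTerm_one (a c t : ℝ) (n : ℤ) :
    thetaTerm 1 a c t n =
      exp (-π * c ^ 2 * t) * (jacobiTheta₂'_term n (a + I * c * t) (I * t) / (2 * π * I) +
        c * jacobiTheta₂_term n (a + I * c * t) (I * t)) := by
  have h := thetaTerm_zero a c t n
  have h1 : thetaTerm 1 a c t n = (n + c) * thetaTerm 0 a c t n := by
    simp [thetaTerm, mul_assoc]
  rw [h1, h, jacobiTheta₂'_term]
  have : (π : ℂ) ≠ 0 := ofReal_ne_zero.mpr Real.pi_ne_zero
  field_simp [I_ne_zero]

theorem im_I_mul_pos {t : ℝ} (ht : 0 < t) : 0 < (I * t : ℂ).im := by simpa using ht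

theorem hasSum_thetaTerm_zero (a c : ℝ) {t : ℝ} (ht : 0 < t) :
    HasSum (thetaTerm 0 a c t) (exp (-π * c ^ 2 * t) * jacobiTheta₂ (a + I * c * t) (I * t)) := by
  rw [funext (thetaTerm_zero a c t)]
  exact (hasSum_jacobiTheta₂_term _ (im_I_mul_pos ht)).mul_left _

theorem hasSum_thetaTerm_one (a c : ℝ) {t : ℝ} (ht : 0 < t) :
    HasSum (thetaTerm 1 a c t) (exp (-π * c ^ 2 * t) *
      (jacobiTheta₂' (a + I * c * t) (I * t) / (2 * π * I) +
        c * jacobiTheta₂ (a + I * c * t) (I * t))) := by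
  rw [funext (thetaTerm_one a c t)]
  exact (((hasSum_jacobiTheta₂'_term _ (im_I_mul_pos ht)).div_const _).add
    ((hasSum_jacobiTheta₂_term _ (im_I_mul_pos ht)).mul_left _)).mul_left _

theorem theta_zero_eq (a c : ℝ) {t : ℝ} (ht : 0 < t) : theta 0 a c t =
    exp (-π * c ^ 2 * t) * jacobiTheta₂ (a + I * c * t) (I * t) :=
  (hasSum_thetaTerm_zero a c ht).tsum_eq

theorem theta_one_eq (a c : ℝ) {t : ℝ} (ht : 0 < t) : theta 1 a c t =
    exp (-π * c ^ 2 * t) * (jacobiTheta₂' (a + I * c * t) (I * t) / (2 * π * I) +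
        c * jacobiTheta₂ (a + I * c * t) (I * t)) :=
  (hasSum_thetaTerm_one a c ht).tsum_eq

theorem hasSum_theta (k : Fin 2) (a c : ℝ) {t : ℝ} (ht : 0 < t) :
    HasSum (thetaTerm k a c t) (theta k a c t) := by
  fin_cases k
  · exact (hasSum_thetaTerm_zero a c ht).summable.hasSum
  · exact (hasSum_thetaTerm_one a c ht).summable.hasSum

theorem continuousOn_theta (k : Fin 2) (a c : ℝ) : ContinuousOn (theta k a c) (Ioi 0) := by
  have h0 : ContinuousOn (fun t : ℝ => jacobiTheta₂ (a + I * c * t) (I * t)) (Ioi 0) := by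
    intro t ht
    exact (ContinuousAt.comp (f := fun t : ℝ => ((a + I * c * t, I * t) : ℂ × ℂ))
      (continuousAt_jacobiTheta₂ _ (im_I_mul_pos ht)) (by fun_prop)).continuousWithinAt
  have h1 : ContinuousOn (fun t : ℝ => jacobiTheta₂' (a + I * c * t) (I * t)) (Ioi 0) := by
    intro t ht
    exact (ContinuousAt.comp (f := fun t : ℝ => ((a + I * c * t, I * t) : ℂ × ℂ))
      (continuousAt_jacobiTheta₂' _ (im_I_mul_pos ht)) (by fun_prop)).continuousWithinAt
  fin_cases k
  · exact ContinuousOn.congr (by fun_prop) fun t ht => theta_zero_eq a c ht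
  · exact ContinuousOn.congr (by fun_prop) fun t ht => theta_one_eq a c ht

/-- The first characteristic has period `1`. Jacobi's transformation produces `-c`, whereas the unit
square requires `1 - c`. -/
theorem theta_one_sub (k : ℕ) (a c t : ℝ) : theta k (1 - c) a t = theta k (-c) a t := by
  refine tsum_congr fun n => ?_
  rw [thetaTerm, thetaTerm]
  congr 2
  rw [show (2 * π * I * n * ((1 - c : ℝ) : ℂ)) = 2 * π * I * n * ((-c : ℝ) : ℂ) + n * (2 * π * I) by
    push_cast; ring, exp_add, exp_int_mul_two_pi_mul_I, mul_one]

/-- The functional equation of the theta series. -/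
theorem theta_functional_equation (k : Fin 2) (a c : ℝ) {t : ℝ} (ht : 0 < t) :
    theta k a c (1 / t) = I ^ (k : ℕ) * exp (-2 * π * I * a * c) *
      ((t ^ (1 / 2 + (k : ℕ) : ℝ) : ℝ) : ℂ) * theta k (1 - c) a t := by
  have ht' : 0 < 1 / t := one_div_pos.mpr ht
  have htc : (t : ℂ) ≠ 0 := ofReal_ne_zero.mpr ht.ne'
  have hpi : (π : ℂ) ≠ 0 := ofReal_ne_zero.mpr Real.pi_ne_zero
  have hdiv : ((a : ℂ) + I * c * (1 / t : ℝ)) / (I * (1 / t : ℝ)) =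
      -(((-c : ℝ) : ℂ) + I * a * t) := by
    push_cast
    field_simp [I_ne_zero]
    linear_combination (a * t : ℂ) * I_sq
  have hinv : -1 / (I * (1 / t : ℝ)) = I * t := by
    push_cast
    field_simp [I_ne_zero]
    exact I_sq.symm
  have hroot : 1 / (-I * (I * (1 / t : ℝ))) ^ (1 / 2 : ℂ) = ((t ^ (1 / 2 : ℝ) : ℝ) : ℂ) := by
    rw [show -I * (I * (1 / t : ℝ)) = ((1 / t : ℝ) : ℂ) by linear_combination -(1 / t : ℝ) * I_sq,
      show (1 / 2 : ℂ) = ((1 / 2 : ℝ) : ℂ) by norm_num, ← ofReal_cpow ht'.le,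
      ← ofReal_one, ← ofReal_div, one_div t, Real.inv_rpow ht.le, one_div, inv_inv]
  have hexp : exp (-π * c ^ 2 * (1 / t : ℝ)) *
      exp (-π * I * (a + I * c * (1 / t : ℝ)) ^ 2 / (I * (1 / t : ℝ))) =
      exp (-2 * π * I * a * c) * exp (-π * a ^ 2 * t) := by
    rw [← exp_add, ← exp_add]
    congr 1
    push_cast
    field_simp [I_ne_zero]
    linear_combination (-c ^ 2 : ℂ) * I_sq
  rw [theta_one_sub]
  fin_cases k
  · simp only [pow_zero, Nat.cast_zero, add_zero]
    rw [theta_zero_eq a c ht', theta_zero_eq (-c) a ht, jacobiTheta₂_functional_equation,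
      hdiv, hinv, jacobiTheta₂_neg_left, hroot]
    linear_combination ((t ^ (1 / 2 : ℝ) : ℝ) : ℂ) *
      jacobiTheta₂ (((-c : ℝ) : ℂ) + I * a * t) (I * t) * hexp
  · simp only [pow_one, Nat.cast_one]
    rw [theta_one_eq a c ht', theta_one_eq (-c) a ht, jacobiTheta₂_functional_equation,
      jacobiTheta₂'_functional_equation,
      hdiv, hinv, jacobiTheta₂_neg_left, jacobiTheta₂'_neg_left, hroot, Real.rpow_add ht,
      Real.rpow_one]
    set J := jacobiTheta₂ (((-c : ℝ) : ℂ) + I * a * t) (I * t)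
    set J' := jacobiTheta₂' (((-c : ℝ) : ℂ) + I * a * t) (I * t)
    set r := ((t ^ (1 / 2 : ℝ) : ℝ) : ℂ)
    set E := exp (-π * I * (a + I * c * (1 / t : ℝ)) ^ 2 / (I * (1 / t : ℝ)))
    -- The part `I * c / t` of the elliptic variable cancels the summand `c * (r * E * J)`. What is
    -- left is the weight-one combination with `a` in place of `c`, times the extra factor `I * t`.
    have : exp (-π * c ^ 2 * (1 / t : ℝ)) * (r * E / (I * (1 / t : ℝ)) *
        (-J' - 2 * π * I * (a + I * c * (1 / t : ℝ)) * J) / (2 * π * I) + c * (r * E * J)) =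
        (exp (-π * c ^ 2 * (1 / t : ℝ)) * E) * (I * (r * t) * (J' / (2 * π * I) + a * J)) := by
      push_cast
      field_simp [I_ne_zero]
      linear_combination (-(r * E * t * J') - 2 * r * E * t * π * I * a * J) * I_sq
    rw [this, hexp]
    push_cast
    ring

/-! ### Calculus of at most simple poles. -/

/-- `f` has at most a simple pole at `z₀`. -/
def AtMostSimplePoleAt (f : ℂ → ℂ) (z₀ : ℂ) : Prop :=
  ∃ g : ℂ → ℂ, AnalyticAt ℂ g z₀ ∧ ∀ᶠ z in 𝓝[≠] z₀, f z = (z - z₀)⁻¹ * g z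

namespace AtMostSimplePoleAt

variable {f g : ℂ → ℂ} {z₀ : ℂ}

theorem of_analyticAt (hf : AnalyticAt ℂ f z₀) : AtMostSimplePoleAt f z₀ := by
  refine ⟨fun z => (z - z₀) * f z, by fun_prop, ?_⟩
  filter_upwards [self_mem_nhdsWithin] with z hz
  rw [inv_mul_cancel_left₀ (sub_ne_zero.mpr hz)]

theorem add (hf : AtMostSimplePoleAt f z₀) (hg : AtMostSimplePoleAt g z₀) :
    AtMostSimplePoleAt (fun z => f z + g z) z₀ := by
  obtain ⟨F, hF, hF'⟩ := hf
  obtain ⟨G, hG, hG'⟩ := hg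
  refine ⟨fun z => F z + G z, by fun_prop, ?_⟩
  filter_upwards [hF', hG'] with z h1 h2
  rw [h1, h2, mul_add]

theorem analyticAt_mul (hg : AnalyticAt ℂ g z₀) (hf : AtMostSimplePoleAt f z₀) :
    AtMostSimplePoleAt (fun z => g z * f z) z₀ := by
  obtain ⟨F, hF, hF'⟩ := hf
  refine ⟨fun z => g z * F z, by fun_prop, ?_⟩
  filter_upwards [hF'] with z h1
  rw [h1, mul_left_comm]

theorem congr (hf : AtMostSimplePoleAt f z₀) (h : f =ᶠ[𝓝[≠] z₀] g) :
    AtMostSimplePoleAt g z₀ := by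
  obtain ⟨F, hF, hF'⟩ := hf
  refine ⟨F, hF, ?_⟩
  filter_upwards [hF', h] with z h1 h2
  rw [← h2, h1]

theorem sum {ι : Type*} {f : ι → ℂ → ℂ} (s : Finset ι)
    (h : ∀ i ∈ s, AtMostSimplePoleAt (f i) z₀) :
    AtMostSimplePoleAt (fun z => ∑ i ∈ s, f i z) z₀ := by
  classical
  induction s using Finset.induction_on with
  | empty => simpa using of_analyticAt (z₀ := z₀) (f := fun _ => 0) analyticAt_const
  | insert i s hi ih =>
    simp only [Finset.sum_insert hi]
    exact (h i (Finset.mem_insert_self i s)).add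
      (ih fun j hj => h j (Finset.mem_insert_of_mem hj))

theorem inv_add (w : ℂ) : AtMostSimplePoleAt (fun z => (z + w)⁻¹) z₀ := by
  by_cases h : z₀ + w = 0
  · refine ⟨fun _ => 1, analyticAt_const, Eventually.of_forall fun z => ?_⟩
    rw [mul_one, eq_neg_of_add_eq_zero_left h, sub_neg_eq_add]
  · exact of_analyticAt ((analyticAt_id.add analyticAt_const).inv h)

theorem comp_affine {α β : ℂ} (hα : α ≠ 0) (hf : AtMostSimplePoleAt f (α * z₀ + β)) :
    AtMostSimplePoleAt (fun z => f (α * z + β)) z₀ := by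
  obtain ⟨F, hF, hF'⟩ := hf
  refine ⟨fun z => α⁻¹ * F (α * z + β), ?_, ?_⟩
  · exact analyticAt_const.mul (hF.comp_of_eq (g := F) (f := fun z => α * z + β) (by fun_prop) rfl)
  · have ht : Tendsto (fun z => α * z + β) (𝓝[≠] z₀) (𝓝[≠] (α * z₀ + β)) := by
      refine tendsto_nhdsWithin_iff.mpr ⟨?_, ?_⟩
      · exact (Continuous.tendsto (by fun_prop) z₀).mono_left nhdsWithin_le_nhds
      · filter_upwards [self_mem_nhdsWithin] with z hz
        simpa [hα] using hz
    filter_upwards [ht.eventually hF'] with z hz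
    rw [hz, show α * z + β - (α * z₀ + β) = α * (z - z₀) by ring, mul_inv]
    ring

theorem meromorphicAt (hf : AtMostSimplePoleAt f z₀) : MeromorphicAt f z₀ := by
  obtain ⟨F, hF, hF'⟩ := hf
  have h : MeromorphicAt (fun z => (z - z₀)⁻¹ * F z) z₀ := by fun_prop
  exact h.congr (hF'.mono fun z hz => hz.symm)

theorem neg_one_le_meromorphicOrderAt (hf : AtMostSimplePoleAt f z₀) :
    ((-1 : ℤ) : WithTop ℤ) ≤ meromorphicOrderAt f z₀ := by
  obtain ⟨F, hF, hF'⟩ := hf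
  have h1 : MeromorphicAt (fun z => (z - z₀)⁻¹) z₀ := by fun_prop
  have h2 : meromorphicOrderAt (fun z => (z - z₀)⁻¹) z₀ = ((-1 : ℤ) : WithTop ℤ) :=
    (meromorphicOrderAt_eq_int_iff h1).mpr ⟨fun _ => 1, analyticAt_const, one_ne_zero,
      Eventually.of_forall fun z => by simp⟩
  rw [meromorphicOrderAt_congr (f₂ := (fun z => (z - z₀)⁻¹) * F) hF',
    meromorphicOrderAt_mul h1 hF.meromorphicAt, h2]
  exact le_add_of_nonneg_right hF.meromorphicOrderAt_nonneg

end AtMostSimplePoleAt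

/-! ### Incomplete gamma functions. -/

/-- The series `∑ (-x)^j / (j! (z + j))` of the lower incomplete gamma function divided
by `x ^ z`. -/
noncomputable def lowerGammaSeries (x : ℝ) (z : ℂ) : ℂ :=
  ∑' j : ℕ, (((-x) ^ j / j.factorial : ℝ) : ℂ) * (z + j)⁻¹

/-- The sequence tends to `0`, hence is bounded. A vanishing denominator contributes `0⁻¹ = 0`, so
the poles need not be excluded. -/
theorem exists_norm_inv_add_natCast_le (z : ℂ) : ∃ C : ℝ, ∀ j : ℕ, ‖(z + j)⁻¹‖ ≤ C := by
  have h : Tendsto (fun j : ℕ => (z + j)⁻¹) atTop (𝓝 0) := by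
    refine tendsto_inv₀_cobounded.comp ?_
    exact (tendsto_const_add_cobounded z).comp (tendsto_natCast_atTop_cobounded (α := ℂ))
  obtain ⟨C, hC⟩ := (Metric.isBounded_range_of_tendsto _ h).exists_norm_le
  exact ⟨C, fun j => hC _ (mem_range_self j)⟩

theorem norm_neg_pow_div_factorial_le {x R : ℝ} (hx : |x| ≤ R) (j : ℕ) :
    ‖(((-x) ^ j / j.factorial : ℝ) : ℂ)‖ ≤ R ^ j / j.factorial := by
  rw [norm_real, norm_div, norm_pow, norm_neg, Real.norm_eq_abs, Real.norm_natCast]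
  gcongr

theorem summable_lowerGammaSeries (x : ℝ) (z : ℂ) :
    Summable fun j : ℕ => (((-x) ^ j / j.factorial : ℝ) : ℂ) * (z + j)⁻¹ := by
  obtain ⟨C, hC⟩ := exists_norm_inv_add_natCast_le z
  refine ((Real.summable_pow_div_factorial |x|).mul_right C).of_norm_bounded fun j => ?_
  rw [norm_mul]
  exact mul_le_mul (norm_neg_pow_div_factorial_le le_rfl j) (hC j) (norm_nonneg _) (by positivity)

theorem continuous_lowerGammaSeries (z : ℂ) : Continuous fun x => lowerGammaSeries x z := by
  obtain ⟨C, hC⟩ := exists_norm_inv_add_natCast_le z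
  refine continuous_iff_continuousAt.mpr fun x₀ => ?_
  have h : ContinuousOn (fun x => lowerGammaSeries x z) (Metric.ball 0 (|x₀| + 1)) := by
    refine continuousOn_tsum (fun j => by fun_prop)
      ((Real.summable_pow_div_factorial (|x₀| + 1)).mul_right C) fun j x hx => ?_
    rw [norm_mul]
    refine mul_le_mul (norm_neg_pow_div_factorial_le ?_ j) (hC j) (norm_nonneg _) (by positivity)
    simpa using (mem_ball_zero_iff.mp hx).le
  exact h.continuousAt (Metric.isOpen_ball.mem_nhds (by simp))

/-- Dropping `N` terms moves the remaining poles out of the half-plane `1 < Re z + N`. There all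
denominators have norm at least `1`, and the exponential series dominates. -/
theorem analyticAt_lowerGammaSeries_tail (x : ℝ) {N : ℕ} {z₀ : ℂ} (hz : 1 < z₀.re + N) :
    AnalyticAt ℂ (fun z : ℂ => ∑' j : ℕ,
      (((-x) ^ (j + N) / (j + N).factorial : ℝ) : ℂ) * (z + (j + N : ℕ))⁻¹) z₀ := by
  have ho : IsOpen {z : ℂ | 1 < z.re + N} := isOpen_lt continuous_const (by fun_prop)
  have hb : ∀ (j : ℕ) (z : ℂ), 1 < z.re + N → 1 ≤ ‖z + (j + N : ℕ)‖ := by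
    intro j z hz
    refine le_trans ?_ (re_le_norm _)
    rw [add_re, natCast_re]
    push_cast
    have : (0 : ℝ) ≤ j := j.cast_nonneg
    linarith
  refine (differentiableOn_tsum_of_summable_norm (u := fun j : ℕ =>
    |x| ^ (j + N) / (j + N).factorial) ?_ ?_ ho ?_).analyticAt (ho.mem_nhds hz)
  · exact (summable_nat_add_iff N).mpr (Real.summable_pow_div_factorial |x|)
  · intro j z hz
    have : z + (j + N : ℕ) ≠ 0 := norm_pos_iff.mp (zero_lt_one.trans_le (hb j z hz))
    have hd : DifferentiableAt ℂ (fun z : ℂ => z + ((j + N : ℕ) : ℂ)) z := by fun_prop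
    exact ((hd.fun_inv this).const_mul _).differentiableWithinAt
  · intro j z hz
    rw [norm_mul, norm_inv]
    refine (mul_le_mul (norm_neg_pow_div_factorial_le le_rfl _) (inv_le_one_of_one_le₀ (hb j z hz))
      (by positivity) (by positivity)).trans (mul_one _).le

theorem lowerGammaSeries_eq_sum_add (x : ℝ) (N : ℕ) (z : ℂ) : lowerGammaSeries x z =
    (∑ j ∈ Finset.range N, (((-x) ^ j / j.factorial : ℝ) : ℂ) * (z + j)⁻¹) + ∑' j : ℕ,
      (((-x) ^ (j + N) / (j + N).factorial : ℝ) : ℂ) * (z + (j + N : ℕ))⁻¹ :=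
  ((summable_lowerGammaSeries x z).sum_add_tsum_nat_add N).symm

theorem analyticAt_lowerGammaSeries (x : ℝ) {z₀ : ℂ} (hz : ∀ j : ℕ, z₀ ≠ -j) :
    AnalyticAt ℂ (lowerGammaSeries x) z₀ := by
  obtain ⟨N, hN⟩ := exists_nat_gt (1 - z₀.re)
  rw [funext (lowerGammaSeries_eq_sum_add x N)]
  refine AnalyticAt.fun_add (Finset.analyticAt_fun_sum _ fun j _ => ?_)
    (analyticAt_lowerGammaSeries_tail x (by linarith))
  exact analyticAt_const.mul ((analyticAt_id.add analyticAt_const).inv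
    fun h => hz j (eq_neg_of_add_eq_zero_left h))

theorem atMostSimplePoleAt_lowerGammaSeries (x : ℝ) (z₀ : ℂ) :
    AtMostSimplePoleAt (lowerGammaSeries x) z₀ := by
  obtain ⟨N, hN⟩ := exists_nat_gt (1 - z₀.re)
  rw [funext (lowerGammaSeries_eq_sum_add x N)]
  refine AtMostSimplePoleAt.add (.sum _ fun j _ => ?_)
    (.of_analyticAt (analyticAt_lowerGammaSeries_tail x (by linarith)))
  exact AtMostSimplePoleAt.analyticAt_mul (g := fun _ => (((-x) ^ j / j.factorial : ℝ) : ℂ))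
    analyticAt_const (.inv_add j)

/-- The exponential is expanded in powers of `t` and integrated term by term. -/
theorem integral_Ioc_cpow_mul_exp (x : ℝ) {z : ℂ} (hz : 0 < z.re) :
    ∫ t in Ioc (0 : ℝ) 1, (t : ℂ) ^ (z - 1) * exp (-(x * t)) = lowerGammaSeries x z := by
  have hre : ∀ j : ℕ, -1 < (z - 1 + j : ℂ).re := by
    intro j
    have : (0 : ℝ) ≤ j := j.cast_nonneg
    simp only [add_re, sub_re, one_re, natCast_re]
    linarith
  set F : ℕ → ℝ → ℂ := fun j t => (((-x) ^ j / j.factorial : ℝ) : ℂ) * (t : ℂ) ^ (z - 1 + j)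
  have hint : ∀ j, Integrable (F j) (volume.restrict (Ioc 0 1)) := fun j =>
    (((intervalIntegral.intervalIntegrable_cpow' (a := 0) (b := 1) (hre j)).1).const_mul _)
  have hnorm : ∀ j, ∫ t in Ioc (0 : ℝ) 1, ‖F j t‖ = |x| ^ j / j.factorial * (z.re + j)⁻¹ := by
    intro j
    have h1 : ∀ t ∈ Ioc (0 : ℝ) 1, ‖F j t‖ = |x| ^ j / j.factorial * t ^ (z.re + j - 1) := by
      intro t ht
      simp only [F]
      rw [norm_mul, norm_cpow_eq_rpow_re_of_pos ht.1, norm_real, norm_div, norm_pow, norm_neg,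
        Real.norm_eq_abs, Real.norm_natCast]
      congr 2
      simp
      ring
    have := hre j
    simp only [add_re, sub_re, one_re, natCast_re] at this
    rw [setIntegral_congr_fun measurableSet_Ioc h1, integral_const_mul,
      ← intervalIntegral.integral_of_le zero_le_one, integral_rpow (Or.inl (by linarith)),
      sub_add_cancel, Real.one_rpow, Real.zero_rpow (by linarith), sub_zero, one_div]
  have hsum : Summable fun j => ∫ t in Ioc (0 : ℝ) 1, ‖F j t‖ := by
    simp_rw [hnorm]
    refine ((Real.summable_pow_div_factorial |x|).mul_right z.re⁻¹).of_nonneg_of_le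
      (fun j => by positivity) fun j => ?_
    gcongr
    simp
  have h := hasSum_integral_of_summable_integral_norm hint hsum
  have hL : ∀ j, ∫ t in Ioc (0 : ℝ) 1, F j t =
      (((-x) ^ j / j.factorial : ℝ) : ℂ) * (z + j)⁻¹ := by
    intro j
    have hne : z - 1 + j + 1 ≠ 0 := by
      intro h0
      have h1 := congrArg re h0
      have h2 := hre j
      simp only [add_re, one_re, zero_re] at h1 h2
      linarith
    simp only [F]
    rw [integral_const_mul, ← intervalIntegral.integral_of_le zero_le_one,
      integral_cpow (Or.inl (hre j)), ofReal_one, one_cpow, ofReal_zero, zero_cpow hne, sub_zero,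
      one_div]
    congr 2
    ring
  simp_rw [hL] at h
  rw [lowerGammaSeries, h.tsum_eq]
  refine setIntegral_congr_fun measurableSet_Ioc fun t ht => ?_
  have ht0 : (t : ℂ) ≠ 0 := ofReal_ne_zero.mpr ht.1.ne'
  have h2 : HasSum (fun j => F j t) ((t : ℂ) ^ (z - 1) * exp (-(x * t))) := by
    have h3 := (NormedSpace.expSeries_div_hasSum_exp (-(x * t) : ℂ)).mul_left ((t : ℂ) ^ (z - 1))
    rw [← exp_eq_exp_ℂ] at h3
    refine h3.congr_fun fun j => ?_
    simp only [F]
    rw [cpow_add _ _ ht0, cpow_natCast]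
    push_cast
    rw [← neg_mul, mul_pow]
    ring
  exact h2.tsum_eq.symm

/-- The upper incomplete gamma function. -/
theorem upperMellin_exp {x : ℝ} (hx : 0 < x) {z : ℂ} (hz : ∀ j : ℕ, z ≠ -j) :
    upperMellin (fun t => exp (-(x * t))) z = (x : ℂ) ^ (-z) * Gamma z - lowerGammaSeries x z := by
  have hxc : (x : ℂ) ≠ 0 := ofReal_ne_zero.mpr hx.ne'
  have hU : IsPreconnected (range fun j : ℕ => (-j : ℂ))ᶜ :=
    ((countable_range _).isPathConnected_compl_of_one_lt_rank
      (by rw [rank_real_complex]; norm_num)).isConnected.isPreconnected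
  have hmem : ∀ w : ℂ, w ∈ (range fun j : ℕ => (-j : ℂ))ᶜ ↔ ∀ j : ℕ, w ≠ -j := by
    intro w
    simp [eq_comm]
  have hcont : Continuous fun t : ℝ => exp (-(x * t)) := by fun_prop
  have hO : (fun t : ℝ => exp (-(x * t))) =O[atTop] fun t : ℝ => Real.exp (-x * t) := by
    refine isBigO_of_le _ fun t => ?_
    rw [← ofReal_mul, ← ofReal_neg, ← ofReal_exp, norm_real, neg_mul]
  -- For `Re z > 0` the identity is the gamma integral split at `t = 1`. It continues analytically
  -- because the complement of the countable set of poles is connected.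
  refine AnalyticOnNhd.eqOn_of_preconnected_of_eventuallyEq (𝕜 := ℂ)
    (U := (range fun j : ℕ => (-j : ℂ))ᶜ) (z₀ := 1)
    (f := upperMellin fun t => exp (-(x * t)))
    (g := fun z => (x : ℂ) ^ (-z) * Gamma z - lowerGammaSeries x z) ?_ ?_ hU ?_ ?_
    ((hmem z).mpr hz)
  · exact fun w _ => (differentiable_upperMellin hcont.continuousOn hx hO).analyticAt w
  · intro w hw
    refine AnalyticAt.fun_sub (AnalyticAt.fun_mul ?_ ?_)
      (analyticAt_lowerGammaSeries x ((hmem w).mp hw))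
    · exact (differentiable_neg.const_cpow (Or.inl hxc)).analyticAt w
    · have := (differentiable_one_div_Gamma.analyticAt w).fun_inv
        (inv_ne_zero (Gamma_ne_zero ((hmem w).mp hw)))
      simpa using this
  · rw [hmem]
    intro j h
    have := congrArg re h
    simp only [one_re, neg_re, natCast_re] at this
    linarith [(j.cast_nonneg : (0 : ℝ) ≤ j)]
  · filter_upwards [(isOpen_lt continuous_const continuous_re).mem_nhds
      (show (1 : ℂ) ∈ {w : ℂ | 0 < w.re} by simp)] with w (hw : 0 < w.re)
    have hG := integral_cpow_mul_exp_neg_mul_Ioi hw hx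
    have hI : IntegrableOn (fun t : ℝ => (t : ℂ) ^ (w - 1) * exp (-(x * t))) (Ioi 0) := by
      refine mellinConvergent_of_isBigO_rpow_exp (b := 0) hx
        (hcont.locallyIntegrable.locallyIntegrableOn _) hO ?_ hw
      simp only [neg_zero, Real.rpow_zero]
      exact (hcont.continuousAt.tendsto.mono_left nhdsWithin_le_nhds).isBigO_one ℝ
    rw [← Ioc_union_Ioi_eq_Ioi zero_le_one] at hG hI
    rw [setIntegral_union (Ioc_disjoint_Ioi le_rfl) measurableSet_Ioi hI.left_of_union
      hI.right_of_union, integral_Ioc_cpow_mul_exp x hw] at hG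
    rw [upperMellin_eq_integral, cpow_neg, ← inv_cpow _ _ (by
      rw [arg_ofReal_of_nonneg hx.le]; exact Real.pi_ne_zero.symm), ← one_div, ← hG]
    ring

/-! ### Tails of the theta series, uniformly on the closed square. -/

/-- The part of the theta series over the positive integers. -/
noncomputable def tailTheta (k : ℕ) (a c t : ℝ) : ℂ := ∑' m : ℕ, thetaTerm k a c t (m + 1)

/-- Since `-(n + 1) + c = -(n + (1 - c))`, the negative half of the series is the nonnegative half
at `(1 - a, 1 - c)`, up to a phase and a sign. -/
theorem thetaTerm_neg_add_one (k : ℕ) (a c t : ℝ) (n : ℤ) :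
    thetaTerm k a c t (-(n + 1)) =
      (-1) ^ k * exp (-2 * π * I * a) * thetaTerm k (1 - a) (1 - c) t n := by
  have h1 : exp (2 * π * I * (-(n + 1) : ℤ) * a) =
      exp (-2 * π * I * a) * exp (2 * π * I * n * ((1 - a : ℝ) : ℂ)) := by
    rw [← exp_add, show -2 * π * I * a + 2 * π * I * n * ((1 - a : ℝ) : ℂ) =
      2 * π * I * ((-(n + 1) : ℤ) : ℂ) * a + n * (2 * π * I) by push_cast; ring, exp_add,
      exp_int_mul_two_pi_mul_I, mul_one]
  have h2 : (((-(n + 1) : ℤ) : ℂ) + c) ^ k = (-1) ^ k * ((n : ℂ) + ((1 - c : ℝ) : ℂ)) ^ k := by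
    rw [← mul_pow]
    congr 1
    push_cast
    ring
  have h3 : (((-(n + 1) : ℤ) : ℝ) + c) ^ 2 = (n + (1 - c)) ^ 2 := by
    push_cast
    ring
  rw [thetaTerm, thetaTerm, h1, h2, h3]
  ring

/-- The theta series, split into its two central terms and two tails. -/
theorem theta_eq_head_add_tail (k : Fin 2) (a c : ℝ) {t : ℝ} (ht : 0 < t) :
    theta k a c t = (thetaTerm k a c t 0 + tailTheta k a c t) +
      (-1) ^ (k : ℕ) * exp (-2 * π * I * a) *
        (thetaTerm k (1 - a) (1 - c) t 0 + tailTheta k (1 - a) (1 - c) t) := by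
  have half : ∀ a c : ℝ, HasSum (fun n : ℕ => thetaTerm k a c t n)
      (thetaTerm k a c t 0 + tailTheta k a c t) := by
    intro a c
    have hs : Summable fun n : ℕ => thetaTerm k a c t n :=
      (hasSum_theta k a c ht).summable.comp_injective Nat.cast_injective
    have := hs.hasSum
    rw [hs.tsum_eq_zero_add] at this
    simpa [tailTheta] using this
  refine (hasSum_theta k a c ht).unique (HasSum.of_nat_of_neg_add_one (half a c) ?_)
  simp_rw [thetaTerm_neg_add_one]
  exact (half (1 - a) (1 - c)).mul_left _

theorem norm_thetaTerm (k : ℕ) (a c t : ℝ) (n : ℤ) :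
    ‖thetaTerm k a c t n‖ = |n + c| ^ k * Real.exp (-π * (n + c) ^ 2 * t) := by
  have h : ‖exp (2 * π * I * n * a)‖ = 1 := by
    rw [show (2 * π * I * n * a : ℂ) = ((2 * π * n * a : ℝ) : ℂ) * I by push_cast; ring,
      norm_exp_ofReal_mul_I]
  rw [thetaTerm, norm_mul, norm_mul, h, norm_pow, mul_one, norm_real, Real.norm_eq_abs,
    Real.abs_exp]
  congr 2
  rw [← ofReal_intCast, ← ofReal_add, norm_real, Real.norm_eq_abs]

/-- Here `m + 1 + c ≥ 1` even at `c = 0`, so `π (m + 1 + c)^2 t ≥ (m + 1) t ≥ m + t`. The bound is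
uniform in `a` and `c` because the index `0` is left out. -/
theorem norm_thetaTerm_succ_le (k : Fin 2) (a : ℝ) {c t : ℝ} (hc : c ∈ Icc (0 : ℝ) 1)
    (ht : 1 ≤ t) (m : ℕ) :
    ‖thetaTerm k a c t (m + 1)‖ ≤ (m + 2) * Real.exp (-1 * m) * Real.exp (-1 * t) := by
  have hm : (0 : ℝ) ≤ m := m.cast_nonneg
  have h0 := hc.1
  have h1 := hc.2
  have hpi := Real.pi_gt_three
  rw [norm_thetaTerm, mul_assoc (m + 2 : ℝ), ← Real.exp_add]
  push_cast
  gcongr ?_ * Real.exp ?_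
  · rw [abs_of_nonneg (by positivity)]
    fin_cases k
    · simp only [pow_zero]
      linarith
    · simp only [pow_one]
      linarith
  · have h2 : (m : ℝ) + 1 ≤ (m + 1 + c) ^ 2 := by nlinarith
    have h3 : (m : ℝ) + 1 ≤ π * (m + 1 + c) ^ 2 := by nlinarith
    nlinarith [mul_le_mul h3 ht zero_le_one (by positivity)]

theorem summable_tail_bound :
    Summable fun m : ℕ => ((m : ℝ) + 2) * Real.exp (-1 * m) := by
  have h1 := Real.summable_pow_mul_exp_neg_nat_mul 1 one_pos
  have h0 := Real.summable_pow_mul_exp_neg_nat_mul 0 one_pos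
  refine (h1.add (h0.mul_left 2)).congr fun m => ?_
  ring

theorem continuousOn_tailTheta (k : Fin 2) :
    ContinuousOn (fun q : (ℝ × ℝ) × ℝ => tailTheta k q.1.1 q.1.2 q.2) (closedSquare ×ˢ Ici 1) := by
  refine continuousOn_tsum (u := fun m : ℕ => ((m : ℝ) + 2) * Real.exp (-1 * m)) (fun m => ?_)
    summable_tail_bound fun m q hq => ?_
  · unfold thetaTerm
    fun_prop
  · refine (norm_thetaTerm_succ_le k q.1.1 hq.1.2 hq.2 m).trans
      (mul_le_of_le_one_right (by positivity) ?_)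
    have : (1 : ℝ) ≤ q.2 := hq.2
    rw [Real.exp_le_one_iff]
    linarith

theorem norm_tailTheta_le (k : Fin 2) (a : ℝ) {c t : ℝ} (hc : c ∈ Icc (0 : ℝ) 1) (ht : 1 ≤ t) :
    ‖tailTheta k a c t‖ ≤ (∑' m : ℕ, ((m : ℝ) + 2) * Real.exp (-1 * m)) * Real.exp (-1 * t) :=
  tsum_of_norm_bounded (summable_tail_bound.hasSum.mul_right _)
    fun m => norm_thetaTerm_succ_le k a hc ht m

theorem continuousOn_tailTheta_right (k : Fin 2) {p : ℝ × ℝ} (hp : p ∈ closedSquare) :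
    ContinuousOn (tailTheta k p.1 p.2) (Ici 1) :=
  (continuousOn_tailTheta k).comp (f := fun t : ℝ => (p, t)) (by fun_prop)
    fun t ht => ⟨hp, ht⟩

theorem isBigO_tailTheta (k : Fin 2) {p : ℝ × ℝ} (hp : p ∈ closedSquare) :
    tailTheta k p.1 p.2 =O[atTop] fun t => Real.exp (-1 * t) := by
  refine IsBigO.of_bound (∑' m : ℕ, ((m : ℝ) + 2) * Real.exp (-1 * m)) ?_
  filter_upwards [eventually_ge_atTop 1] with t ht
  rw [Real.norm_eq_abs, Real.abs_exp]
  exact norm_tailTheta_le k p.1 hp.2 ht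

theorem differentiable_upperMellin_tailTheta (k : Fin 2) {p : ℝ × ℝ} (hp : p ∈ closedSquare) :
    Differentiable ℂ (upperMellin (tailTheta k p.1 p.2)) :=
  differentiable_upperMellin (continuousOn_tailTheta_right k hp) one_pos (isBigO_tailTheta k hp)

theorem continuousOn_upperMellin_tailTheta (k : Fin 2) (z : ℂ) :
    ContinuousOn (fun p : ℝ × ℝ => upperMellin (tailTheta k p.1 p.2) z) closedSquare := by
  simp_rw [upperMellin_eq_integral]
  set C := ∑' m : ℕ, ((m : ℝ) + 2) * Real.exp (-1 * m)
  have hz : ContinuousOn (fun t : ℝ => (t : ℂ) ^ (z - 1)) (Ici 1) := fun t (ht : 1 ≤ t) =>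
    (continuousAt_ofReal_cpow_const t (z - 1)
      (Or.inr (by linarith))).continuousWithinAt
  -- Raising the exponent to `max z.re 1 - 1` makes the bound a convergent gamma integrand for every
  -- `z`.
  refine continuousOn_of_dominated
    (bound := fun t => t ^ (max z.re 1 - 1) * (C * Real.exp (-1 * t))) ?_ ?_ ?_ ?_
  · intro p hp
    exact ((hz.mul (continuousOn_tailTheta_right k hp)).mono
      Ioi_subset_Ici_self).aestronglyMeasurable measurableSet_Ioi
  · intro p hp
    refine (ae_restrict_iff' measurableSet_Ioi).mpr (Eventually.of_forall fun t (ht : 1 < t) => ?_)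
    rw [norm_mul, norm_cpow_eq_rpow_re_of_pos (by linarith), sub_re, one_re]
    refine mul_le_mul (Real.rpow_le_rpow_of_exponent_le ht.le ?_)
      (norm_tailTheta_le k p.1 hp.2 ht.le) (norm_nonneg _) (Real.rpow_nonneg (by linarith) _)
    gcongr
    exact le_max_left _ _
  · have h : IntegrableOn (fun t : ℝ => C * (Real.exp (-t) * t ^ (max z.re 1 - 1))) (Ioi 0) :=
      (Real.GammaIntegral_convergent (by positivity)).const_mul C
    refine (h.mono_set (Ioi_subset_Ioi zero_le_one)).congr (Eventually.of_forall fun t => ?_)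
    simp only [neg_mul, one_mul]
    ring
  · refine (ae_restrict_iff' measurableSet_Ioi).mpr (Eventually.of_forall fun t (ht : 1 < t) => ?_)
    refine continuousOn_const.mul ?_
    exact (continuousOn_tailTheta k).comp (f := fun p : ℝ × ℝ => (p, t)) (by fun_prop)
      fun p hp => ⟨hp, ht.le⟩

/-! ### Decay and entire Mellin transform for interior parameters. -/

theorem isBigO_exp_neg {b b' : ℝ} (h : b ≤ b') :
    (fun t : ℝ => Real.exp (-b' * t)) =O[atTop] fun t => Real.exp (-b * t) := by
  refine IsBigO.of_bound 1 ?_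
  filter_upwards [eventually_ge_atTop 0] with t ht
  rw [Real.norm_eq_abs, Real.norm_eq_abs, Real.abs_exp, Real.abs_exp, one_mul]
  gcongr

theorem isBigO_thetaTerm_zero (k : ℕ) (a c : ℝ) :
    (fun t => thetaTerm k a c t 0) =O[atTop] fun t => Real.exp (-(π * c ^ 2) * t) := by
  refine IsBigO.of_bound (|c| ^ k) (Eventually.of_forall fun t => ?_)
  rw [norm_thetaTerm, Real.norm_eq_abs, Real.abs_exp]
  simp

theorem one_sub_mem_openSquare {a c : ℝ} (h : (a, c) ∈ openSquare) :
    (1 - a, 1 - c) ∈ openSquare := by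
  obtain ⟨⟨h1, h2⟩, h3, h4⟩ := h
  exact ⟨⟨sub_pos.mpr h2, sub_lt_self _ h1⟩, sub_pos.mpr h4, sub_lt_self _ h3⟩

theorem dual_mem_openSquare {a c : ℝ} (h : (a, c) ∈ openSquare) : (1 - c, a) ∈ openSquare := by
  obtain ⟨⟨h1, h2⟩, h3, h4⟩ := h
  exact ⟨⟨sub_pos.mpr h4, sub_lt_self _ h3⟩, h1, h2⟩

theorem one_sub_mem_closedSquare {a c : ℝ} (h : (a, c) ∈ closedSquare) :
    (1 - a, 1 - c) ∈ closedSquare := by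
  obtain ⟨⟨h1, h2⟩, h3, h4⟩ := h
  exact ⟨⟨sub_nonneg.mpr h2, sub_le_self _ h1⟩, sub_nonneg.mpr h4, sub_le_self _ h3⟩

theorem dual_mem_closedSquare {a c : ℝ} (h : (a, c) ∈ closedSquare) :
    (1 - c, a) ∈ closedSquare := by
  obtain ⟨⟨h1, h2⟩, h3, h4⟩ := h
  exact ⟨⟨sub_nonneg.mpr h4, sub_le_self _ h3⟩, h1, h2⟩

theorem openSquare_subset_closedSquare : openSquare ⊆ closedSquare :=
  prod_mono Ioo_subset_Icc_self Ioo_subset_Icc_self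

/-- For interior parameters the theta series decays exponentially. -/
theorem isBigO_theta (k : Fin 2) {a c : ℝ} (h : (a, c) ∈ openSquare) :
    ∃ b > 0, theta k a c =O[atTop] fun t => Real.exp (-b * t) := by
  have hc : 0 < c := h.2.1
  have hc' : 0 < 1 - c := sub_pos.mpr h.2.2
  have key : ∀ b : ℝ, b ≤ 1 → ∀ a c : ℝ, (a, c) ∈ openSquare → b ≤ π * c ^ 2 →
      (fun t => thetaTerm k a c t 0 + tailTheta k a c t) =O[atTop] fun t => Real.exp (-b * t) := by
    intro b hb a c h hbc
    exact ((isBigO_thetaTerm_zero k a c).trans (isBigO_exp_neg hbc)).add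
      ((isBigO_tailTheta k (openSquare_subset_closedSquare h)).trans (isBigO_exp_neg hb))
  set b := min 1 (min (π * c ^ 2) (π * (1 - c) ^ 2))
  refine ⟨b, by positivity, ?_⟩
  have h1 := key b (min_le_left _ _) a c h ((min_le_right _ _).trans (min_le_left _ _))
  have h2 := key b (min_le_left _ _) (1 - a) (1 - c) (one_sub_mem_openSquare h)
    ((min_le_right _ _).trans (min_le_right _ _))
  refine (h1.add (h2.const_mul_left ((-1) ^ (k : ℕ) * exp (-2 * π * I * a)))).congr' ?_
    EventuallyEq.rfl
  filter_upwards [eventually_gt_atTop 0] with t ht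
  rw [theta_eq_head_add_tail k a c ht]

theorem isBigO_theta_rpow (k : Fin 2) {a c : ℝ} (h : (a, c) ∈ openSquare) (r : ℝ) :
    theta k a c =O[atTop] fun t => t ^ r := by
  obtain ⟨b, hb, hO⟩ := isBigO_theta k h
  exact hO.trans (isLittleO_exp_neg_mul_rpow_atTop hb r).isBigO

/-- The theta series with dual parameters, as a pair related by a functional equation. -/
noncomputable def thetaPair (k : Fin 2) {a c : ℝ} (h : (a, c) ∈ openSquare) : WeakFEPair ℂ where
  f := theta k a c
  g := theta k (1 - c) a
  k := 1 / 2 + (k : ℕ)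
  ε := I ^ (k : ℕ) * exp (-2 * π * I * a * c)
  -- No constant terms occur, since `n + c` and `n + a` never vanish for interior parameters. Hence
  -- the Mellin transform is entire.
  f₀ := 0
  g₀ := 0
  hf_int := (continuousOn_theta k a c).locallyIntegrableOn measurableSet_Ioi
  hg_int := (continuousOn_theta k (1 - c) a).locallyIntegrableOn measurableSet_Ioi
  hk := by positivity
  hε := mul_ne_zero (pow_ne_zero _ I_ne_zero) (exp_ne_zero _)
  h_feq := fun t ht => theta_functional_equation k a c ht
  hf_top := fun r => by simpa using isBigO_theta_rpow k h r
  hg_top := fun r => by simpa using isBigO_theta_rpow k (dual_mem_openSquare h) r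

theorem isStrongFEPair_thetaPair (k : Fin 2) {a c : ℝ} (h : (a, c) ∈ openSquare) :
    IsStrongFEPair (thetaPair k h) := ⟨rfl, rfl⟩

theorem mellinConvergent_theta (k : Fin 2) {a c : ℝ} (h : (a, c) ∈ openSquare) (z : ℂ) :
    MellinConvergent (theta k a c) z :=
  ((isStrongFEPair_thetaPair k h).hasMellin z).1

theorem differentiable_mellin_theta (k : Fin 2) {a c : ℝ} (h : (a, c) ∈ openSquare) :
    Differentiable ℂ (mellin (theta k a c)) := by
  have h1 : mellin (theta k a c) = (thetaPair k h).Λ :=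
    funext fun z => ((isStrongFEPair_thetaPair k h).hasMellin z).2
  rw [h1]
  exact (isStrongFEPair_thetaPair k h).differentiable_Λ

/-! ### The bilateral series and `L^±`. -/

/-- The entire function `∑ sgn(n + c)^k e^{2 π i n a} |n + c|^{-s}` (sum over all integers). -/
noncomputable def bilateralLerch (k : ℕ) (s : ℂ) (a c : ℝ) : ℂ :=
  mellin (theta k a c) ((s + k) / 2) * (Gammaℝ (s + k))⁻¹

theorem differentiable_bilateralLerch (k : Fin 2) {a c : ℝ} (h : (a, c) ∈ openSquare) :
    Differentiable ℂ fun s => bilateralLerch k s a c := by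
  have h1 := differentiable_mellin_theta k h
  have h2 := differentiable_Gammaℝ_inv
  exact (h1.comp (f := fun s : ℂ => (s + (k : ℕ)) / 2) (by fun_prop)).mul
    (h2.comp (f := fun s : ℂ => s + (k : ℕ)) (by fun_prop))

theorem int_add_ne_zero {c : ℝ} (hc : c ∈ Ioo (0 : ℝ) 1) (n : ℤ) : (n : ℝ) + c ≠ 0 := by
  intro h
  have h1 : (n : ℝ) < 0 := by linarith [hc.1]
  have h2 : (-1 : ℝ) < n := by linarith [hc.2]
  have h3 : n < 0 := by exact_mod_cast h1
  have h4 : -1 < n := by exact_mod_cast h2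
  omega

theorem hasSum_bilateralLerch (k : Fin 2) {a c : ℝ} (h : (a, c) ∈ openSquare) {s : ℂ}
    (hs : 1 < s.re) :
    HasSum (fun n : ℤ => exp (2 * π * I * n * a) * (SignType.sign ((n : ℝ) + c) : ℂ) ^ (k : ℕ) /
      ((|(n : ℝ) + c| : ℝ) : ℂ) ^ s) (bilateralLerch k s a c) := by
  have hs0 : 0 < s.re := zero_lt_one.trans hs
  have hsum : Summable fun n : ℤ => ‖exp (2 * π * I * n * a)‖ / |(n : ℝ) + c| ^ s.re := by
    refine ((Real.summable_one_div_int_add_rpow c s.re).mpr hs).congr fun n => ?_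
    rw [show (2 * π * I * n * a : ℂ) = ((2 * π * n * a : ℝ) : ℂ) * I by push_cast; ring,
      norm_exp_ofReal_mul_I]
  have hθ : ∀ t ∈ Ioi (0 : ℝ), HasSum (thetaTerm k a c t) (theta k a c t) :=
    fun t ht => hasSum_theta k a c ht
  have hG : Gammaℝ (s + (k : ℕ)) ≠ 0 := by
    refine Gammaℝ_ne_zero_of_re_pos ?_
    rw [add_re, natCast_re]
    positivity
  rw [bilateralLerch]
  fin_cases k
  · have h1 := hasSum_mellin_pi_mul_sq (a := fun n : ℤ => exp (2 * π * I * n * a))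
      (r := fun n : ℤ => (n : ℝ) + c) (F := theta 0 a c) hs0 (fun t ht => by
        refine (hθ t ht).congr_fun fun n => ?_
        rw [if_neg (int_add_ne_zero h.2 n), thetaTerm]
        simp) hsum
    simp only [Nat.cast_zero, add_zero, pow_zero, mul_one] at hG ⊢
    refine (h1.mul_right (Gammaℝ s)⁻¹).congr_fun fun n => ?_
    field_simp
  · have h1 := hasSum_mellin_pi_mul_sq' (a := fun n : ℤ => exp (2 * π * I * n * a))
      (r := fun n : ℤ => (n : ℝ) + c) (F := theta 1 a c) hs0 (fun t ht => by
        refine (hθ t ht).congr_fun fun n => ?_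
        rw [thetaTerm]
        push_cast
        simp only [pow_one]
        ring) hsum
    simp only [Nat.cast_one, pow_one] at hG ⊢
    refine (h1.mul_right (Gammaℝ (s + 1))⁻¹).congr_fun fun n => ?_
    field_simp

/-- The average `(1 + sgn(n + c))/2` is the indicator of `n ≥ 0`, so the mean of the even and odd
bilateral series is the Lerch series. -/
theorem isLerchContinuation_bilateralLerch {a c : ℝ} (h : (a, c) ∈ openSquare) :
    IsLerchContinuation a c
      fun s => (bilateralLerch (0 : Fin 2) s a c + bilateralLerch (1 : Fin 2) s a c) / 2 := by
  refine ⟨((differentiable_bilateralLerch 0 h).add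
    (differentiable_bilateralLerch 1 h)).div_const 2, fun s hs => ?_⟩
  have h1 := ((hasSum_bilateralLerch 0 h hs).add (hasSum_bilateralLerch 1 h hs)).div_const 2
  rw [← Function.Injective.hasSum_iff (Nat.cast_injective (R := ℤ))] at h1
  · refine h1.congr_fun fun n => ?_
    have hpos : (0 : ℝ) < n + c := by linarith [h.2.1, (n.cast_nonneg : (0 : ℝ) ≤ n)]
    simp only [Function.comp_apply, Int.cast_natCast]
    rw [sign_pos hpos, abs_of_pos hpos, cpow_neg]
    simp
    ring
  · intro n hn
    have hn0 : n < 0 := by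
      by_contra hn0
      exact hn ⟨n.toNat, Int.toNat_of_nonneg (not_lt.mp hn0)⟩
    have hneg : (n : ℝ) + c < 0 := by
      have : (n : ℝ) ≤ -1 := by exact_mod_cast Int.le_sub_one_of_lt hn0
      linarith [h.2.2]
    rw [sign_neg hneg]
    simp
    ring

theorem isLerchContinuation_lerchZeta {a c : ℝ} (h : (a, c) ∈ openSquare) :
    IsLerchContinuation a c fun s => lerchZeta s a c := by
  have hex : ∃ f : ℂ → ℂ, IsLerchContinuation a c f := ⟨_, isLerchContinuation_bilateralLerch h⟩
  simp only [lerchZeta, dif_pos hex]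
  exact hex.choose_spec

theorem lerchZeta_eq {a c : ℝ} (h : (a, c) ∈ openSquare) (s : ℂ) :
    lerchZeta s a c =
      (bilateralLerch (0 : Fin 2) s a c + bilateralLerch (1 : Fin 2) s a c) / 2 :=
  congrFun ((isLerchContinuation_lerchZeta h).unique (isLerchContinuation_bilateralLerch h)) s

theorem exp_neg_mul_exp_neg_one_sub (a : ℝ) :
    exp (-2 * π * I * a) * exp (-2 * π * I * ((1 - a : ℝ) : ℂ)) = 1 := by
  rw [← exp_add, show -2 * π * I * a + -2 * π * I * ((1 - a : ℝ) : ℂ) =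
    ((-1 : ℤ) : ℂ) * (2 * π * I) by push_cast; ring, exp_int_mul_two_pi_mul_I]

theorem neg_one_pow_mul_self (k : ℕ) : ((-1 : ℂ) ^ k) * (-1) ^ k = 1 := by
  rw [← mul_pow]
  simp

theorem bilateralLerch_reflection (k : Fin 2) (s : ℂ) (a c : ℝ) :
    (-1) ^ (k : ℕ) * exp (-2 * π * I * a) * bilateralLerch k s (1 - a) (1 - c) =
      bilateralLerch k s a c := by
  rw [bilateralLerch, bilateralLerch, ← mul_assoc, ← smul_eq_mul (_ * _) (mellin _ _),
    ← mellin_const_smul]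
  congr 1
  refine setIntegral_congr_fun measurableSet_Ioi fun t ht => ?_
  simp only [smul_eq_mul]
  rw [theta_eq_head_add_tail k a c ht, theta_eq_head_add_tail k (1 - a) (1 - c) ht, sub_sub_cancel,
    sub_sub_cancel]
  linear_combination ((t : ℂ) ^ ((s + (k : ℕ)) / 2 - 1)) *
    (thetaTerm k a c t 0 + tailTheta k a c t) *
    ((-1) ^ (k : ℕ) * (-1) ^ (k : ℕ) * exp_neg_mul_exp_neg_one_sub a + neg_one_pow_mul_self k)

/-- By reflection, `e^{-2πia} ζ(s, 1 - a, 1 - c)` is half the difference of the even and odd series.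
Adding it to or subtracting it from `ζ(s, a, c)` isolates one parity. -/
theorem lerchL_eq (k : Fin 2) {a c : ℝ} (h : (a, c) ∈ openSquare) (s : ℂ) :
    lerchL k s a c = bilateralLerch k s a c := by
  have h0 := bilateralLerch_reflection 0 s a c
  have h1 := bilateralLerch_reflection 1 s a c
  rw [lerchL, lerchZeta_eq h, lerchZeta_eq (one_sub_mem_openSquare h)]
  fin_cases k
  · simp only [Fin.isValue, Fin.coe_ofNat_eq_mod, Nat.zero_mod, Nat.mod_succ, pow_zero, pow_one] at h0 h1 ⊢
    linear_combination (1 / 2 : ℂ) * h0 - (1 / 2 : ℂ) * h1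
  · simp only [Fin.isValue, Fin.coe_ofNat_eq_mod, Nat.zero_mod, Nat.mod_succ, pow_zero, pow_one] at h0 h1 ⊢
    linear_combination -(1 / 2 : ℂ) * h0 + (1 / 2 : ℂ) * h1

/-! ### The renormalized function in explicit form. -/

theorem half_ne_neg_natCast (k : ℕ) {s : ℂ} (hs : s ∉ range ((↑) : ℤ → ℂ)) (j : ℕ) :
    (s + k) / 2 ≠ -j := by
  intro h
  refine hs ⟨-2 * j - k, ?_⟩
  push_cast
  linear_combination -2 * h

theorem one_sub_notMem_range_intCast {s : ℂ} (hs : s ∉ range ((↑) : ℤ → ℂ)) :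
    1 - s ∉ range ((↑) : ℤ → ℂ) := by
  rintro ⟨m, hm⟩
  refine hs ⟨1 - m, ?_⟩
  push_cast
  linear_combination -hm

theorem Gammaℝ_add_ne_zero (k : ℕ) {s : ℂ} (hs : s ∉ range ((↑) : ℤ → ℂ)) :
    Gammaℝ (s + k) ≠ 0 := by
  rw [Ne, Gammaℝ_eq_zero_iff]
  rintro ⟨n, hn⟩
  refine half_ne_neg_natCast k hs n ?_
  rw [hn]
  ring

/-- The contribution of the nonnegative integers to the renormalized truncated Mellin transform
of the theta series. -/
noncomputable def renormHalf (k : ℕ) (s : ℂ) (a c : ℝ) : ℂ :=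
  upperMellin (tailTheta k a c) ((s + k) / 2) -
    (c : ℂ) ^ k * lowerGammaSeries (π * c ^ 2) ((s + k) / 2)

/-- The renormalized truncated Mellin transform of the theta series. -/
noncomputable def renormUpper (k : ℕ) (s : ℂ) (a c : ℝ) : ℂ :=
  renormHalf k s a c + (-1) ^ k * exp (-2 * π * I * a) * renormHalf k s (1 - a) (1 - c)

/-- An explicit formula for the renormalized Lerch function on the closed square. -/
noncomputable def renormExplicit (k : ℕ) (s : ℂ) (a c : ℝ) : ℂ :=
  (Gammaℝ (s + k))⁻¹ *
    (renormUpper k s a c + I ^ k * exp (-2 * π * I * a * c) * renormUpper k (1 - s) (1 - c) a)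

theorem thetaTerm_at_zero (k : ℕ) (a c t : ℝ) :
    thetaTerm k a c t 0 = (c : ℂ) ^ k * exp (-((π * c ^ 2 : ℝ) * t)) := by
  rw [thetaTerm, ofReal_exp]
  push_cast
  simp

theorem mellinConvergent_indicator_thetaTerm (k : ℕ) (a : ℝ) {c : ℝ} (hc : 0 < c) (z : ℂ) :
    MellinConvergent (indicator (Ioi 1) fun t => thetaTerm k a c t 0) z := by
  refine mellinConvergent_indicator ?_ (b := π * c ^ 2) (by positivity)
    (isBigO_thetaTerm_zero k a c) z
  unfold thetaTerm
  fun_prop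

theorem mellinConvergent_indicator_tailTheta (k : Fin 2) {a c : ℝ} (h : (a, c) ∈ closedSquare)
    (z : ℂ) : MellinConvergent (indicator (Ioi 1) (tailTheta k a c)) z :=
  mellinConvergent_indicator (continuousOn_tailTheta_right k h) one_pos (isBigO_tailTheta k h) z

/-- The full gamma factor in `upperMellin_exp` becomes `Gammaℝ (s + k) * c ^ (-s)`, which isolates
the non-integer power of `c`. -/
theorem upperMellin_thetaTerm_zero (k : ℕ) (a : ℝ) {c : ℝ} (hc : 0 < c) {s : ℂ}
    (hs : s ∉ range ((↑) : ℤ → ℂ)) :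
    upperMellin (fun t => thetaTerm k a c t 0) ((s + k) / 2) =
      Gammaℝ (s + k) * (c : ℂ) ^ (-s) -
        (c : ℂ) ^ k * lowerGammaSeries (π * c ^ 2) ((s + k) / 2) := by
  have hcc : (c : ℂ) ≠ 0 := ofReal_ne_zero.mpr hc.ne'
  have hpow : ((π * c ^ 2 : ℝ) : ℂ) ^ (-((s + k) / 2)) =
      (π : ℂ) ^ (-((s + k) / 2)) * (c : ℂ) ^ (-(s + k)) := by
    rw [ofReal_mul, mul_cpow_ofReal_nonneg Real.pi_pos.le (by positivity), ofReal_pow]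
    congr 1
    have harg : arg (c : ℂ) = 0 := arg_ofReal_of_nonneg hc.le
    rw [← cpow_nat_mul' (by simpa [harg] using Real.pi_pos) (by simpa [harg] using Real.pi_pos.le)]
    congr 1
    push_cast
    ring
  simp_rw [thetaTerm_at_zero]
  rw [upperMellin_const_mul, upperMellin_exp (by positivity) (half_ne_neg_natCast k hs), hpow,
    Gammaℝ_def, mul_sub, neg_div, neg_add, cpow_add _ _ hcc, cpow_neg _ (k : ℂ), cpow_natCast]
  field_simp

theorem upperMellin_half (k : Fin 2) {a c : ℝ} (h : (a, c) ∈ openSquare) {s : ℂ}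
    (hs : s ∉ range ((↑) : ℤ → ℂ)) :
    upperMellin (fun t => thetaTerm k a c t 0 + tailTheta k a c t) ((s + (k : ℕ)) / 2) =
      renormHalf k s a c + Gammaℝ (s + (k : ℕ)) * (c : ℂ) ^ (-s) := by
  rw [upperMellin_add (mellinConvergent_indicator_thetaTerm k a h.2.1 _)
    (mellinConvergent_indicator_tailTheta k (openSquare_subset_closedSquare h) _),
    upperMellin_thetaTerm_zero k a h.2.1 hs, renormHalf]
  ring

theorem mellinConvergent_half (k : Fin 2) {a c : ℝ} (h : (a, c) ∈ openSquare) (z : ℂ) :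
    MellinConvergent (indicator (Ioi 1) fun t => thetaTerm k a c t 0 + tailTheta k a c t) z := by
  have := (hasMellin_add (mellinConvergent_indicator_thetaTerm k a h.2.1 z)
    (mellinConvergent_indicator_tailTheta k (openSquare_subset_closedSquare h) z)).1
  convert! this using 1
  exact indicator_add (Ioi 1) _ _

theorem upperMellin_theta (k : Fin 2) {a c : ℝ} (h : (a, c) ∈ openSquare) {s : ℂ}
    (hs : s ∉ range ((↑) : ℤ → ℂ)) :
    upperMellin (theta k a c) ((s + (k : ℕ)) / 2) = renormUpper k s a c +
      Gammaℝ (s + (k : ℕ)) * ((c : ℂ) ^ (-s) +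
        (-1) ^ (k : ℕ) * exp (-2 * π * I * a) * ((1 - c : ℝ) : ℂ) ^ (-s)) := by
  have h' := one_sub_mem_openSquare h
  rw [upperMellin_congr fun t ht => theta_eq_head_add_tail k a c (zero_lt_one.trans ht),
    upperMellin_add (mellinConvergent_half k h _)
      (mellinConvergent_indicator_const_mul _ (mellinConvergent_half k h' _)),
    upperMellin_const_mul, upperMellin_half k h hs, upperMellin_half k h' hs, renormUpper]
  ring

/-- After division by `Gammaℝ (s + k)`, the powers of `c` and `1 - c` come from the integral at `s`.
Those of `a` and `1 - a` come from the dual one, whose quotient of gamma factors is `tateGamma k (1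
- s)`. Together they are `lerchCorrection`. -/
theorem renormLerchInterior_eq (k : Fin 2) {a c : ℝ} (h : (a, c) ∈ openSquare) {s : ℂ}
    (hs : s ∉ range ((↑) : ℤ → ℂ)) :
    renormLerchInterior k s (a, c) = renormExplicit k s a c := by
  have hs' := one_sub_notMem_range_intCast hs
  have hG := Gammaℝ_add_ne_zero k hs
  have hz : (((1 / 2 + (k : ℕ) : ℝ) : ℂ) - (s + (k : ℕ)) / 2) = (1 - s + (k : ℕ)) / 2 := by
    push_cast
    ring
  have hexp : exp (-2 * π * I * a * c) * exp (-2 * π * I * ((1 - c : ℝ) : ℂ)) =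
      exp (2 * π * I * (1 - a) * c) := by
    rw [← exp_add, show -2 * π * I * a * c + -2 * π * I * ((1 - c : ℝ) : ℂ) =
      2 * π * I * (1 - a) * c + ((-1 : ℤ) : ℂ) * (2 * π * I) by push_cast; ring, exp_add,
      exp_int_mul_two_pi_mul_I, mul_one]
  rw [renormLerchInterior, lerchL_eq k h, bilateralLerch,
    mellin_eq_upperMellin_add (fun t ht => theta_functional_equation k a c ht)
      (mellinConvergent_theta k h _), hz, upperMellin_theta k h hs,
    upperMellin_theta k (dual_mem_openSquare h) hs', renormExplicit, lerchCorrection, tateGamma,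
    sub_sub_cancel, neg_sub, ← hexp]
  field_simp
  ring

/-! ### Continuity on the closed square. -/

theorem continuousOn_renormHalf (k : Fin 2) {s : ℂ} :
    ContinuousOn (fun p : ℝ × ℝ => renormHalf k s p.1 p.2) closedSquare := by
  have h1 := continuousOn_upperMellin_tailTheta k ((s + (k : ℕ)) / 2)
  have h2 : Continuous fun p : ℝ × ℝ => lowerGammaSeries (π * p.2 ^ 2) ((s + (k : ℕ)) / 2) :=
    (continuous_lowerGammaSeries _).comp (f := fun p : ℝ × ℝ => π * p.2 ^ 2) (by fun_prop)
  unfold renormHalf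
  fun_prop

theorem continuousOn_renormUpper (k : Fin 2) {s : ℂ} :
    ContinuousOn (fun p : ℝ × ℝ => renormUpper k s p.1 p.2) closedSquare := by
  have h1 := continuousOn_renormHalf k (s := s)
  have h2 : ContinuousOn (fun p : ℝ × ℝ => renormHalf k s (1 - p.1) (1 - p.2)) closedSquare :=
    h1.comp (f := fun p : ℝ × ℝ => (1 - p.1, 1 - p.2)) (by fun_prop)
      fun p hp => one_sub_mem_closedSquare hp
  unfold renormUpper
  fun_prop

theorem continuousOn_renormExplicit (k : Fin 2) (s : ℂ) :
    ContinuousOn (fun p : ℝ × ℝ => renormExplicit k s p.1 p.2) closedSquare := by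
  have h1 := continuousOn_renormUpper k (s := s)
  have h2 : ContinuousOn (fun p : ℝ × ℝ => renormUpper k (1 - s) (1 - p.2) p.1) closedSquare :=
    (continuousOn_renormUpper k).comp (f := fun p : ℝ × ℝ => (1 - p.2, p.1)) (by fun_prop)
      fun p hp => dual_mem_closedSquare hp
  unfold renormExplicit
  fun_prop

theorem closure_openSquare : closure openSquare = closedSquare := by
  rw [openSquare, closure_prod_eq, closure_Ioo zero_ne_one, closedSquare]

theorem renormLerch_eq (k : Fin 2) {a c : ℝ} (h : (a, c) ∈ closedSquare) {s : ℂ}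
    (hs : s ∉ range ((↑) : ℤ → ℂ)) : renormLerch k s a c = renormExplicit k s a c := by
  refine extendFrom_eq (closure_openSquare ▸ h) ?_
  refine (((continuousOn_renormExplicit k s) (a, c) h).mono
    openSquare_subset_closedSquare).tendsto.congr' ?_
  filter_upwards [self_mem_nhdsWithin] with p hp
  exact (renormLerchInterior_eq k hp hs).symm

/-! ### The functional equation. -/

theorem renormUpper_reflection (k : ℕ) (s : ℂ) (a c : ℝ) :
    (-1) ^ k * exp (-2 * π * I * a) * renormUpper k s (1 - a) (1 - c) = renormUpper k s a c := by
  rw [renormUpper, renormUpper, sub_sub_cancel, sub_sub_cancel]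
  linear_combination renormHalf k s a c *
    ((-1) ^ k * (-1) ^ k * exp_neg_mul_exp_neg_one_sub a + neg_one_pow_mul_self k)

/-- Applying the duality twice sends `(a, c)` to `(1 - a, 1 - c)`. The accumulated factor `(-1)^k
e^{-2πia}` is the one removed by `renormUpper_reflection`. -/
theorem renormExplicit_functional_equation (k : ℕ) {s : ℂ} (hs : s ∉ range ((↑) : ℤ → ℂ))
    (a c : ℝ) : Gammaℝ (s + k) * renormExplicit k s a c =
      I ^ k * exp (-2 * π * I * a * c) *
        (Gammaℝ (1 - s + k) * renormExplicit k (1 - s) (1 - c) a) := by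
  have hI : I ^ k * I ^ k = (-1) ^ k := by rw [← mul_pow, I_mul_I]
  have hexp : exp (-2 * π * I * a * c) * exp (-2 * π * I * ((1 - c : ℝ) : ℂ) * a) =
      exp (-2 * π * I * a) := by
    rw [← exp_add]
    congr 1
    push_cast
    ring
  rw [renormExplicit, renormExplicit, mul_inv_cancel_left₀ (Gammaℝ_add_ne_zero k hs),
    mul_inv_cancel_left₀ (Gammaℝ_add_ne_zero k (one_sub_notMem_range_intCast hs)),
    sub_sub_cancel, ← renormUpper_reflection k s a c, ← hexp, ← hI]
  ring

/-! ### Meromorphy in `s`. -/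

theorem analyticAt_renormHalf (k : Fin 2) {a c : ℝ} (h : (a, c) ∈ closedSquare) {s : ℂ}
    (hs : s ∉ range ((↑) : ℤ → ℂ)) : AnalyticAt ℂ (fun s => renormHalf k s a c) s := by
  have hd : AnalyticAt ℂ (fun s : ℂ => (s + (k : ℕ)) / 2) s := by fun_prop
  have h1 : AnalyticAt ℂ (fun s => upperMellin (tailTheta k a c) ((s + (k : ℕ)) / 2)) s :=
    ((differentiable_upperMellin_tailTheta k h).analyticAt _).comp_of_eq hd rfl
  have h2 : AnalyticAt ℂ (fun s => lowerGammaSeries (π * c ^ 2) ((s + (k : ℕ)) / 2)) s :=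
    (analyticAt_lowerGammaSeries _ (half_ne_neg_natCast k hs)).comp_of_eq hd rfl
  exact h1.fun_sub (analyticAt_const.fun_mul h2)

theorem analyticAt_renormUpper (k : Fin 2) {a c : ℝ} (h : (a, c) ∈ closedSquare) {s : ℂ}
    (hs : s ∉ range ((↑) : ℤ → ℂ)) : AnalyticAt ℂ (fun s => renormUpper k s a c) s :=
  (analyticAt_renormHalf k h hs).fun_add
    (analyticAt_const.fun_mul (analyticAt_renormHalf k (one_sub_mem_closedSquare h) hs))

theorem analyticAt_inv_Gammaℝ_add (k : ℕ) (s : ℂ) :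
    AnalyticAt ℂ (fun s => (Gammaℝ (s + k))⁻¹) s :=
  (differentiable_Gammaℝ_inv.comp (f := fun s : ℂ => s + k) (by fun_prop)).analyticAt s

theorem analyticAt_renormExplicit (k : Fin 2) {a c : ℝ} (h : (a, c) ∈ closedSquare) {s : ℂ}
    (hs : s ∉ range ((↑) : ℤ → ℂ)) : AnalyticAt ℂ (fun s => renormExplicit k s a c) s := by
  have h1 : AnalyticAt ℂ (fun s => renormUpper k (1 - s) (1 - c) a) s :=
    (analyticAt_renormUpper k (dual_mem_closedSquare h)
      (one_sub_notMem_range_intCast hs)).comp_of_eq (f := fun s => 1 - s) (by fun_prop) rfl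
  exact (analyticAt_inv_Gammaℝ_add k s).fun_mul
    ((analyticAt_renormUpper k h hs).fun_add (analyticAt_const.fun_mul h1))

theorem atMostSimplePoleAt_renormHalf (k : Fin 2) {a c : ℝ} (h : (a, c) ∈ closedSquare) (s : ℂ) :
    AtMostSimplePoleAt (fun s => renormHalf k s a c) s := by
  have hd : AnalyticAt ℂ (fun s : ℂ => (s + (k : ℕ)) / 2) s := by fun_prop
  have h1 : AnalyticAt ℂ (fun s => upperMellin (tailTheta k a c) ((s + (k : ℕ)) / 2)) s :=
    ((differentiable_upperMellin_tailTheta k h).analyticAt _).comp_of_eq hd rfl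
  have h2 := (atMostSimplePoleAt_lowerGammaSeries (π * c ^ 2)
    (2⁻¹ * s + (k : ℕ) / 2)).comp_affine (inv_ne_zero two_ne_zero)
  have h3 := (AtMostSimplePoleAt.of_analyticAt h1).add
    (h2.analyticAt_mul (g := fun _ => -(c : ℂ) ^ (k : ℕ)) analyticAt_const)
  convert! h3 using 2 with s
  rw [renormHalf, show (s + (k : ℕ)) / 2 = 2⁻¹ * s + (k : ℕ) / 2 by ring]
  ring

theorem atMostSimplePoleAt_renormUpper (k : Fin 2) {a c : ℝ} (h : (a, c) ∈ closedSquare) (s : ℂ) :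
    AtMostSimplePoleAt (fun s => renormUpper k s a c) s :=
  (atMostSimplePoleAt_renormHalf k h s).add
    ((atMostSimplePoleAt_renormHalf k (one_sub_mem_closedSquare h) s).analyticAt_mul
      analyticAt_const)

theorem atMostSimplePoleAt_renormExplicit (k : Fin 2) {a c : ℝ} (h : (a, c) ∈ closedSquare)
    (s : ℂ) : AtMostSimplePoleAt (fun s => renormExplicit k s a c) s := by
  have h1 := (atMostSimplePoleAt_renormUpper k (dual_mem_closedSquare h)
    (-1 * s + 1)).comp_affine (neg_ne_zero.mpr one_ne_zero)
  have h2 := ((atMostSimplePoleAt_renormUpper k h s).add (h1.analyticAt_mul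
    (g := fun _ => I ^ (k : ℕ) * exp (-2 * π * I * a * c)) analyticAt_const)).analyticAt_mul
    (analyticAt_inv_Gammaℝ_add k s)
  convert! h2 using 2 with s
  rw [renormExplicit, show 1 - s = -1 * s + 1 by ring]

theorem isClosedEmbedding_intCast : IsClosedEmbedding ((↑) : ℤ → ℂ) := by
  have h := isometry_ofReal.isClosedEmbedding.comp Int.isClosedEmbedding_coe_real
  exact h

theorem eventually_notMem_range_intCast (s : ℂ) :
    ∀ᶠ z in 𝓝[≠] s, z ∉ range ((↑) : ℤ → ℂ) := by
  have hc : IsClosed (((↑) : ℤ → ℂ) '' (((↑) : ℤ → ℂ) ⁻¹' {s}ᶜ)) :=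
    isClosedEmbedding_intCast.isClosedMap _ (isClosed_discrete _)
  have hs : s ∉ ((↑) : ℤ → ℂ) '' (((↑) : ℤ → ℂ) ⁻¹' {s}ᶜ) := by
    rintro ⟨m, hm, rfl⟩
    exact hm rfl
  filter_upwards [nhdsWithin_le_nhds (hc.isOpen_compl.mem_nhds hs), self_mem_nhdsWithin]
    with z hz hzs
  rintro ⟨m, rfl⟩
  exact hz ⟨m, hzs, rfl⟩

/-- Only a punctured neighbourhood matters, so the values of `renormLerch` at integers, where the
explicit formula is not established, play no role. -/
theorem atMostSimplePoleAt_renormLerch (k : Fin 2) {a c : ℝ} (h : (a, c) ∈ closedSquare) (s : ℂ) :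
    AtMostSimplePoleAt (fun s => renormLerch k s a c) s := by
  refine (atMostSimplePoleAt_renormExplicit k h s).congr ?_
  filter_upwards [eventually_notMem_range_intCast s] with z hz
  exact (renormLerch_eq k h hz).symm

theorem analyticAt_renormLerch (k : Fin 2) {a c : ℝ} (h : (a, c) ∈ closedSquare) {s : ℂ}
    (hs : s ∉ range ((↑) : ℤ → ℂ)) : AnalyticAt ℂ (fun s => renormLerch k s a c) s := by
  refine (analyticAt_renormExplicit k h hs).congr ?_
  filter_upwards [isClosedEmbedding_intCast.isClosed_range.isOpen_compl.mem_nhds hs] with z hz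
  exact (renormLerch_eq k h hz).symm

end Lerch

theorem mainTheorem8 :
    -- the Lerch zeta function is the entire continuation of its series
    (∀ a ∈ Ioo (0 : ℝ) 1, ∀ c ∈ Ioo (0 : ℝ) 1,
      IsLerchContinuation a c (fun s => lerchZeta s a c)) ∧
    ∀ k : Fin 2,
      -- (1) continuous extension to the closed square
      (∀ s : ℂ, s ∉ range ((↑) : ℤ → ℂ) →
        EqOn (fun p : ℝ × ℝ => renormLerch k s p.1 p.2) (renormLerchInterior k s) openSquare ∧
        ContinuousOn (fun p : ℝ × ℝ => renormLerch k s p.1 p.2) closedSquare) ∧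
      -- (2) meromorphy in `s`, with at most simple poles, all of them at integers
      (∀ a c : ℝ, (a, c) ∈ closedSquare →
        MeromorphicOn (fun s => renormLerch k s a c) univ ∧
        (∀ s : ℂ, s ∉ range ((↑) : ℤ → ℂ) → AnalyticAt ℂ (fun s => renormLerch k s a c) s) ∧
        (∀ m : ℤ, ((-1 : ℤ) : WithTop ℤ) ≤
          meromorphicOrderAt (fun s => renormLerch k s a c) (m : ℂ))) ∧
      -- (3) functional equation, with `w_+ = 1` and `w_- = i`
      (∀ s : ℂ, s ∉ range ((↑) : ℤ → ℂ) → ∀ a c : ℝ, (a, c) ∈ closedSquare →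
        completedRenormLerch k s a c =
          I ^ (k : ℕ) * exp (-2 * Real.pi * I * a * c) *
            completedRenormLerch k (1 - s) (1 - c) a) := by
  refine ⟨fun a ha c hc => Lerch.isLerchContinuation_lerchZeta ⟨ha, hc⟩, fun k =>
    ⟨fun s hs => ⟨fun p hp => ?_, ?_⟩, fun a c h => ⟨fun s _ => ?_, fun s hs => ?_, fun m => ?_⟩,
      fun s hs a c h => ?_⟩⟩
  · exact (Lerch.renormLerch_eq k (Lerch.openSquare_subset_closedSquare hp) hs).trans
      (Lerch.renormLerchInterior_eq k hp hs).symm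
  · exact (Lerch.continuousOn_renormExplicit k s).congr fun p hp => Lerch.renormLerch_eq k hp hs
  · exact (Lerch.atMostSimplePoleAt_renormLerch k h s).meromorphicAt
  · exact Lerch.analyticAt_renormLerch k h hs
  · exact (Lerch.atMostSimplePoleAt_renormLerch k h m).neg_one_le_meromorphicOrderAt
  · rw [completedRenormLerch, completedRenormLerch, Lerch.renormLerch_eq k h hs,
      Lerch.renormLerch_eq k (Lerch.dual_mem_closedSquare h)
        (Lerch.one_sub_notMem_range_intCast hs)]
    exact Lerch.renormExplicit_functional_equation k hs a c
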